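/- Let $m\ge 1$, let $\mathcal D_m=\langle s,r\mid s^2=r^m=srsr=e\rangle$ be the dihedral group of order $2m$, and let all modules be finite-dimensional over $\mathbb K=\mathbb R$ or $\mathbb C$. Let $\mathrm{id}$ be the trivial character, $\varepsilon$ the linear character with $\varepsilon(r)=1$, $\varepsilon(s)=-1$, and, when $m$ is even, $\gamma$ one of the two linear characters with $\gamma(r)=-1$, $\gamma(s)=\pm1$ (either choice is allowed). For $1\le i<m/2$ let $\chi_i$ be the character with $\chi_i(r^a)=2\cos(2\pi ia/m)$ and $\chi_i(r^as)=0$. Put $y_i=r^{1-i}s+r^i\in\mathbb R\mathcal D_m$. If $m=2k$ is even, let $\mathcal Q=\mathcal L\{e,\,r^k,\,rs,\,r^{k+1}s,\,y_i,\,y_irs\}_{1\le i\le k-1}\subseteq\mathbb R\mathcal D_m$, and if $m=2k+1$ is odd, let $\mathcal Q=\mathcal L\{e,\,rs,\,y_i,\,y_irs\}_{1\le i\le k}$. The listed elements form a basis $\{b_i\}_{i\in I}$ of $\mathcal Q$, the space $\mathcal Q$ is a subalgebra of $\mathbb R\mathcal D_m$, and there is an algebra morphism $\theta:\mathcal Q\to\mathbb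 R\,\mathrm{Irr}(\mathcal D_m)$ given by $\theta(e)=\mathrm{id}$, $\theta(rs)=\varepsilon$, $\theta(y_i)=\theta(y_irs)=\chi_i$ and, for $m$ even, $\theta(r^k)=\gamma$, $\theta(r^{k+1}s)=\gamma\varepsilon$. For $g\in\mathcal D_m$ and $f\in\mathbb R\mathcal D_m$ let $[g]f$ be the coefficient of $g$ in $f$, and let $\mathrm{supp}(f)=\{g\in\mathcal D_m : [g]f\ne0\}$. Let $\Gamma=\Gamma(\mathcal D_m,\mathrm{supp}(f))$ be the oriented Cayley graph with vertex set $\mathcal D_m$ and an edge from $g$ to $ga$ for every $g\in\mathcal D_m$ and $a\in\mathrm{supp}(f)$, where $a$ has weight $\omega(a)=[a]f$. Let $w(\sigma,d;\Gamma)$ be the set of words $w=a_1\cdots a_d$ of length $d$ in the letters $\mathrm{supp}(f)$ that reduce to $\sigma$, i.e. that label a path in $\Gamma$ from $e$ to $\sigma$, and let $\omega(w)=\omega(a_1)\cdots\omega(a_d)$. **Theorem.** Let $V$ be a $\mathcal D_m$-module with character $\chi^V$ and let $f\in\mathcal Q$ satisfy $\theta(f)=\chi^V$. For every $i\in I$ let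 $\sigma_i$ be any element of $\mathrm{supp}(b_i)$. Then for every simple $\mathcal D_m$-module $V^{(k)}$, with character $\chi^{(k)}$, and every $d\ge0$, the multiplicity of $V^{(k)}$ in $V^{\otimes d}$ is equal to $$\sum_{\substack{i\in I\\ \theta(b_i)=\chi^{(k)}}}\ \sum_{w\in w(\sigma_i,d;\Gamma)}\omega(w).$$ -/

import Mathlib

open scoped MonoidAlgebra

noncomputable section

namespace DihedralWords

open DihedralGroup

/-! ### Characters, tensor powers and multiplicities -/

/-- The characters of the irreducible representations of `G` over `𝕜`
(a finite-dimensional representation may be realised on some `𝕜ⁿ`). -/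
def irrCharacters (𝕜 : Type*) [RCLike 𝕜] (G : Type*) [Group G] : Set (G → 𝕜) :=
  {χ | ∃ (n : ℕ) (ρ : Representation 𝕜 G (Fin n → 𝕜)), ρ.IsIrreducible ∧ ρ.character = χ}

/-- The character algebra `ℝ Irr(G)`, with the pointwise operations. -/
def characterAlgebra (𝕜 : Type*) [RCLike 𝕜] (G : Type*) [Group G] : Subalgebra ℝ (G → 𝕜) :=
  Algebra.adjoin ℝ (irrCharacters 𝕜 G)

/-- The diagonal action of `G` on `V^{⊗d}`. -/
def tensorPower {𝕜 : Type*} [RCLike 𝕜] {G : Type*} [Group G] {V : Type*} [AddCommGroup V]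
    [Module 𝕜 V] (ρ : Representation 𝕜 G V) (d : ℕ) :
    Representation 𝕜 G (PiTensorProduct 𝕜 fun _ : Fin d => V) :=
  PiTensorProduct.mapMonoidHom.comp (MonoidHom.pi fun _ : Fin d => ρ)

/-- The multiplicity of the simple module `S` in the (finite-dimensional, semisimple) module `W`:
the number of simple summands isomorphic to `S` in a decomposition of `W`, that is, the length of
the `S`-isotypic component of `W`. -/
def simpleMultiplicity {𝕜 : Type*} [RCLike 𝕜] {G : Type*} [Group G] {S W : Type*} [AddCommGroup S]
    [Module 𝕜 S] [AddCommGroup W] [Module 𝕜 W]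
    (σ : Representation 𝕜 G S) (ρ : Representation 𝕜 G W) : ℕ :=
  (Module.length 𝕜[G] (isotypicComponent 𝕜[G] ρ.asModule σ.asModule)).toNat

/-! ### Words in a weighted Cayley graph -/

/-- In the Cayley graph `Γ(G, A)` there is an edge from `g` to `h` associated to `a`
when `a ∈ A` and `h = g a`. -/
def CayleyEdge {G : Type*} [Group G] (A : Set G) (a g h : G) : Prop :=
  a ∈ A ∧ h = g * a

/-- `CayleyPath A g w h`: the word `w` labels a path from `g` to `h` in `Γ(G, A)`. -/
inductive CayleyPath {G : Type*} [Group G] (A : Set G) : G → List G → G → Prop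
  | nil (g : G) : CayleyPath A g [] g
  | cons {a g h l : G} {w : List G} :
      CayleyEdge A a g h → CayleyPath A h w l → CayleyPath A g (a :: w) l

open scoped Classical in
/-- `w(σ, d; Γ(G, A))`: the words of length `d` which reduce to `σ` in `Γ(G, A)`. -/
def words {G : Type*} [Group G] [Fintype G] (A : Set G) (d : ℕ) (σ : G) :
    Finset (Fin d → G) :=
  Finset.univ.filter fun w => CayleyPath A 1 (List.ofFn w) σ

/-- The weight of a word is the product of the weights of its letters. -/
def wordWeight {G : Type*} (ω : G → ℝ) {d : ℕ} (w : Fin d → G) : ℝ :=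
  ∏ j, ω (w j)

/-- The support of an element of the group algebra. -/
def supp {G : Type*} (f : ℝ[G]) : Set G := {g | f.coeff g ≠ 0}

/-! ### The basis `{bᵢ}` and the irreducible characters of the dihedral group

In `DihedralGroup m` the rotation `rᵃ` is `r a`, the reflection `s` is `sr 0`, and
`sr a = s rᵃ = r⁻ᵃ s`. -/

/-- The index set `I` of the basis `{bᵢ}`. -/
inductive Index (m : ℕ) : Type
  /-- the element `e` -/
  | e : Index m
  /-- the element `r s` -/
  | rs : Index m
  /-- the element `r^k`, when `m = 2k` -/
  | rk (hm : Even m) : Index m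
  /-- the element `r^(k+1) s`, when `m = 2k` -/
  | rks (hm : Even m) : Index m
  /-- the element `yᵢ`, for `1 ≤ i < m / 2` -/
  | y (i : ℕ) (hi : 1 ≤ i ∧ 2 * i < m) : Index m
  /-- the element `yᵢ r s`, for `1 ≤ i < m / 2` -/
  | yrs (i : ℕ) (hi : 1 ≤ i ∧ 2 * i < m) : Index m

/-- `yᵢ = r^(1-i) s + rⁱ`. -/
def yElt (m i : ℕ) : ℝ[DihedralGroup m] :=
  .of ℝ _ (r (1 - (i : ZMod m)) * sr 0) + .of ℝ _ (r (i : ZMod m))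

/-- The elements `bᵢ` of the group algebra. -/
def bElt (m : ℕ) : Index m → ℝ[DihedralGroup m]
  | .e => .of ℝ _ 1
  | .rs => .of ℝ _ (r 1 * sr 0)
  | .rk _ => .of ℝ _ (r ((m / 2 : ℕ) : ZMod m))
  | .rks _ => .of ℝ _ (r ((m / 2 + 1 : ℕ) : ZMod m) * sr 0)
  | .y i _ => yElt m i
  | .yrs i _ => yElt m i * .of ℝ _ (r 1 * sr 0)

/-- The character `ε`: `ε(rᵃ) = 1` and `ε(rᵃ s) = -1`. -/
def epsChar (𝕜 : Type*) [RCLike 𝕜] (m : ℕ) : DihedralGroup m → 𝕜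
  | r _ => 1
  | sr _ => -1

/-- The character `γ` for `m` even: `γ(rᵃ) = (-1)ᵃ` and `γ(rᵃ s) = (-1)ᵃ δ`, where `δ = γ(s)` is
`1` or `-1`. -/
def gammaChar (𝕜 : Type*) [RCLike 𝕜] (m : ℕ) (δ : ℤˣ) : DihedralGroup m → 𝕜
  | r a => (-1) ^ a.val
  | sr a => (-1) ^ a.val * ((δ : ℤ) : 𝕜)

/-- The character `χᵢ`: `χᵢ(rᵃ) = 2 cos (2πia/m)` and `χᵢ(rᵃ s) = 0`. -/
def chiChar (𝕜 : Type*) [RCLike 𝕜] (m i : ℕ) : DihedralGroup m → 𝕜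
  | r a => ((2 * Real.cos (2 * Real.pi * i * a.val / m) : ℝ) : 𝕜)
  | sr _ => 0

/-- The irreducible character `χ⁽ⁱ⁾` attached to the basis element `bᵢ`. -/
def indexChar (𝕜 : Type*) [RCLike 𝕜] (m : ℕ) (δ : ℤˣ) : Index m → DihedralGroup m → 𝕜
  | .e => 1
  | .rs => epsChar 𝕜 m
  | .rk _ => gammaChar 𝕜 m δ
  | .rks _ => gammaChar 𝕜 m δ * epsChar 𝕜 m
  | .y i _ => chiChar 𝕜 m i
  | .yrs i _ => chiChar 𝕜 m i

instance (m : ℕ) : Finite (Index m) := by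
  let F : Index m → Fin 6 × Fin (m + 1) := fun x => match x with
    | .e => (0, 0)
    | .rs => (1, 0)
    | .rk _ => (2, 0)
    | .rks _ => (3, 0)
    | .y i hi => (4, ⟨i, by omega⟩)
    | .yrs i hi => (5, ⟨i, by omega⟩)
  refine Finite.of_injective F ?_
  rintro (_ | _ | _ | _ | _ | _) (_ | _ | _ | _ | _ | _) h <;> simp_all [F]

instance (m : ℕ) : Fintype (Index m) := Fintype.ofFinite _

/-! ### Auxiliary facts: linear independence of the `bᵢ` -/

section Aux

variable {m : ℕ}

/-- `r^c` -/
def auxE (c : ZMod m) : ℝ[DihedralGroup m] := .single (r c) 1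

/-- `r^c (rs)` -/
def auxT (c : ZMod m) : ℝ[DihedralGroup m] := .single (sr (-1 - c)) 1

/-- `r^c + r^(-c) (rs)` -/
def auxY (c : ZMod m) : ℝ[DihedralGroup m] := .single (r c) 1 + .single (sr (c - 1)) 1

lemma bElt_e : bElt m .e = auxE 0 := rfl

lemma bElt_rs : bElt m .rs = auxT 0 := by simp [bElt, auxT]

lemma bElt_rk (h : Even m) : bElt m (.rk h) = auxE ((m / 2 : ℕ) : ZMod m) := rfl

lemma bElt_rks (h : Even m) : bElt m (.rks h) = auxT ((m / 2 : ℕ) : ZMod m) := by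
  simp only [bElt, auxT, MonoidAlgebra.of_apply, r_mul_sr]
  congr 2; push_cast; ring

lemma bElt_y (i : ℕ) (h) : bElt m (.y i h) = auxY (i : ZMod m) := by
  simp only [bElt, yElt, auxY, MonoidAlgebra.of_apply, r_mul_sr]
  rw [add_comm]; congr 3; ring

lemma bElt_yrs (i : ℕ) (h) : bElt m (.yrs i h) = auxY (-(i : ZMod m)) := by
  simp only [bElt, yElt, auxY, MonoidAlgebra.of_apply, r_mul_sr, add_mul,
    MonoidAlgebra.single_mul_single, sr_mul_sr, mul_one]
  congr 3 <;> ring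

/-- the exponent `c` for which `bᵢ` is one of `auxE c`, `auxT c`, `auxY c` -/
def auxLbl : Index m → ℕ
  | .e => 0
  | .rs => 0
  | .rk _ => m / 2
  | .rks _ => m / 2
  | .y i _ => i
  | .yrs i _ => m - i

/-- a representative of the support of `bᵢ` -/
def auxRep : Index m → DihedralGroup m
  | .rs => sr (-1 - ((0 : ℕ) : ZMod m))
  | .rks _ => sr (-1 - ((m / 2 : ℕ) : ZMod m))
  | i => r ((auxLbl i : ℕ) : ZMod m)

lemma auxCast {a b : ℕ} (ha : a < m) (hb : b < m) (h : (a : ZMod m) = b) : a = b := by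
  rw [ZMod.natCast_eq_natCast_iff'] at h
  rwa [Nat.mod_eq_of_lt ha, Nat.mod_eq_of_lt hb] at h

lemma auxAdd {a b : ℕ} (h0 : 0 < a + b) (hm : a + b < m)
    (h : (a : ZMod m) + (b : ZMod m) = 0) : False := by
  have h' : ((a + b : ℕ) : ZMod m) = 0 := by push_cast; exact h
  rw [ZMod.natCast_eq_zero_iff] at h'
  exact absurd (Nat.le_of_dvd h0 h') (by omega)

lemma auxPos {a : ℕ} (h0 : 0 < a) (hm : a < m) (h : (a : ZMod m) = 0) : False :=
  auxAdd (a := a) (b := 0) h0 hm (by simpa using h)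

lemma auxCast_sub {i : ℕ} (h : i ≤ m) : ((m - i : ℕ) : ZMod m) = -(i : ZMod m) := by
  rw [Nat.cast_sub h]; simp

lemma bElt_indep (hm : 0 < m) : LinearIndependent ℝ (bElt m) := by
  let φ : Index m → Module.Dual ℝ ℝ[DihedralGroup m] := fun i =>
    (Finsupp.lapply (auxRep i)).comp (MonoidAlgebra.coeffLinearEquiv ℝ).toLinearMap
  have hφ : ∀ i x, φ i x = x.coeff (auxRep i) := fun i x => rfl
  refine LinearIndependent.of_pairwise_dual_eq_zero_one _ φ ?_ ?_
  · intro i j hij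
    rw [hφ]
    rcases i with _ | _ | hi | hi | ⟨i, hi⟩ | ⟨i, hi⟩ <;>
    rcases j with _ | _ | hj | hj | ⟨j, hj⟩ | ⟨j, hj⟩ <;>
    first
    | exact absurd rfl hij
    | (simp only [bElt_e, bElt_rs, bElt_rk, bElt_rks, bElt_y, bElt_yrs, auxE, auxT, auxY, auxRep,
        auxLbl, MonoidAlgebra.coeff_add, MonoidAlgebra.coeff_single, Finsupp.add_apply,
        Finsupp.single_apply, reduceCtorEq, if_false, r.injEq, sr.injEq, add_zero, zero_add]
       all_goals
        refine if_neg fun h => ?_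
        try simp only [Nat.cast_zero] at h
        try rw [auxCast_sub (by omega)] at h
        try have hi2 := even_iff_two_dvd.mp hi
        try have hj2 := even_iff_two_dvd.mp hj
        first
        | exact auxPos (m := m) (a := j) (by omega) (by omega) (by linear_combination h)
        | exact auxPos (m := m) (a := j) (by omega) (by omega) (by linear_combination -h)
        | exact auxPos (m := m) (a := i) (by omega) (by omega) (by linear_combination -h)
        | exact auxPos (m := m) (a := i) (by omega) (by omega) (by linear_combination h)
        | exact auxAdd (m := m) (a := i) (b := j) (by omega) (by omega) (by linear_combination -h)
        | exact auxAdd (m := m) (a := i) (b := j) (by omega) (by omega) (by linear_combination h)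
        | exact auxAdd (m := m) (a := j) (b := m / 2) (by omega) (by omega) (by linear_combination h)
        | exact auxAdd (m := m) (a := j) (b := m / 2) (by omega) (by omega) (by linear_combination -h)
        | exact auxAdd (m := m) (a := i) (b := m / 2) (by omega) (by omega) (by linear_combination h)
        | exact auxAdd (m := m) (a := i) (b := m / 2) (by omega) (by omega) (by linear_combination -h)
        | exact auxPos (m := m) (a := m / 2) (by omega) (by omega) (by linear_combination h)
        | exact auxPos (m := m) (a := m / 2) (by omega) (by omega) (by linear_combination -h)
        | (have hh := auxCast (m := m) (a := j) (b := m / 2) (by omega) (by omega)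
            (by linear_combination h)
           omega)
        | (have hh := auxCast (m := m) (a := j) (b := m / 2) (by omega) (by omega)
            (by linear_combination -h)
           omega)
        | (have hh := auxCast (m := m) (a := i) (b := m / 2) (by omega) (by omega)
            (by linear_combination -h)
           omega)
        | (have hh := auxCast (m := m) (a := i) (b := j) (by omega) (by omega)
            (by linear_combination -h)
           subst hh
           exact hij rfl)
        | (have hh := auxCast (m := m) (a := i) (b := j) (by omega) (by omega)
            (by linear_combination h)
           subst hh
           exact hij rfl))
  · intro i
    rw [hφ]
    rcases i with _ | _ | hi | hi | ⟨i, hi⟩ | ⟨i, hi⟩ <;>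
    simp [bElt_e, bElt_rs, bElt_rk, bElt_rks, bElt_y, bElt_yrs, auxE, auxT, auxY, auxRep, auxLbl]
    rw [auxCast_sub (by omega)]; simp

/-! ### Auxiliary facts: the `χ⁽ⁱ⁾` are irreducible characters -/

variable {𝕜 : Type*} [RCLike 𝕜]

lemma auxIrr {G V : Type*} [Group G] [AddCommGroup V] [Module 𝕜 V] [Nontrivial V]
    (ρ : Representation 𝕜 G V)
    (h : ∀ p : Submodule 𝕜 V, (∀ g, ∀ v ∈ p, ρ g v ∈ p) → p ≠ ⊥ → p = ⊤) : ρ.IsIrreducible where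
  exists_pair_ne := ⟨⊥, ⊤, fun h => bot_ne_top (α := Submodule 𝕜 V)
    (congrArg Subrepresentation.toSubmodule h)⟩
  eq_bot_or_eq_top p := by
    by_cases hp : p.toSubmodule = ⊥
    · exact Or.inl (Subrepresentation.toSubmodule_injective hp)
    · exact Or.inr (Subrepresentation.toSubmodule_injective
        (h _ (fun g v hv => p.apply_mem_toSubmodule g hv) hp))

lemma auxLin {G : Type*} [Group G] (χ : G →* 𝕜) : ⇑χ ∈ irrCharacters 𝕜 G := by
  refine ⟨1, (algebraMap 𝕜 (Module.End 𝕜 (Fin 1 → 𝕜)) : 𝕜 →* _).comp χ, auxIrr _ ?_, ?_⟩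
  · intro p _ hp
    have : IsSimpleModule 𝕜 (Fin 1 → 𝕜) := isSimpleModule_iff_finrank_eq_one.mpr (by simp)
    exact (eq_bot_or_eq_top p).resolve_left hp
  · ext g
    have : (algebraMap 𝕜 (Module.End 𝕜 (Fin 1 → 𝕜))) (χ g) = χ g • LinearMap.id := rfl
    simp [Representation.character, this]

lemma auxPar (hm : Even m) [NeZero m] (a b : ZMod m) :
    (-1 : 𝕜) ^ (a + b).val = (-1) ^ a.val * (-1) ^ b.val := by
  have h2 : Even (m * ((a.val + b.val) / m)) := hm.mul_right _
  rw [← pow_add, ZMod.val_add]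
  conv_rhs => rw [← Nat.mod_add_div (a.val + b.val) m, pow_add, h2.neg_one_pow, mul_one]

lemma auxPar_neg (hm : Even m) [NeZero m] (a : ZMod m) :
    (-1 : 𝕜) ^ (-a).val = (-1) ^ a.val := by
  have h := auxPar (𝕜 := 𝕜) hm a (-a)
  rw [add_neg_cancel, ZMod.val_zero, pow_zero] at h
  rcases neg_one_pow_eq_or 𝕜 a.val with h1 | h1 <;> rw [h1] at h ⊢ <;>
    first | linear_combination -h | linear_combination h

lemma auxPar_sub (hm : Even m) [NeZero m] (a b : ZMod m) :
    (-1 : 𝕜) ^ (a - b).val = (-1) ^ a.val * (-1) ^ b.val := by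
  rw [sub_eq_add_neg, auxPar hm, auxPar_neg hm]

lemma auxDelta (δ : ℤˣ) : ((δ : ℤ) : 𝕜) * ((δ : ℤ) : 𝕜) = 1 := by
  rcases Int.units_eq_one_or δ with rfl | rfl <;> simp

lemma epsChar_mem : epsChar 𝕜 m ∈ irrCharacters 𝕜 (DihedralGroup m) := by
  let χ : DihedralGroup m →* 𝕜 :=
    { toFun := epsChar 𝕜 m
      map_one' := rfl
      map_mul' := by rintro (a | a) (b | b) <;> simp [epsChar] }
  exact auxLin χ

lemma gammaChar_mem [NeZero m] (hm : Even m) (δ : ℤˣ) :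
    gammaChar 𝕜 m δ ∈ irrCharacters 𝕜 (DihedralGroup m) := by
  let χ : DihedralGroup m →* 𝕜 :=
    { toFun := gammaChar 𝕜 m δ
      map_one' := by rw [one_def]; simp [gammaChar]
      map_mul' := by
        have hd := auxDelta (𝕜 := 𝕜) δ
        rintro (a | a) (b | b) <;> simp [gammaChar, auxPar hm, auxPar_sub hm] <;>
          first
          | ring1
          | linear_combination ((-1 : 𝕜) ^ a.val * (-1) ^ b.val) * hd
          | linear_combination (-((-1 : 𝕜) ^ a.val * (-1) ^ b.val)) * hd }
  exact auxLin χ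

lemma gammaEpsChar_mem [NeZero m] (hm : Even m) (δ : ℤˣ) :
    gammaChar 𝕜 m δ * epsChar 𝕜 m ∈ irrCharacters 𝕜 (DihedralGroup m) := by
  convert gammaChar_mem (𝕜 := 𝕜) hm (-δ) using 1
  ext (a | a) <;> simp [gammaChar, epsChar]

/-- the angle `2πca/m` -/
def auxAng (c a : ZMod m) : ℝ := 2 * Real.pi * c.val * a.val / m

lemma auxAng_comm (c a : ZMod m) : auxAng c a = auxAng a c := by
  simp only [auxAng]; ring

lemma auxAng_add [NeZero m] (c a b : ZMod m) :
    ∃ q : ℕ, auxAng c a + auxAng c b = auxAng c (a + b) + q * (2 * Real.pi) := by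
  have h : (m : ℝ) ≠ 0 := Nat.cast_ne_zero.mpr (NeZero.ne m)
  refine ⟨c.val * ((a.val + b.val) / m), ?_⟩
  have e : ((a.val : ℝ) + b.val) = (a + b).val + m * ((a.val + b.val) / m : ℕ) := by
    rw [ZMod.val_add]; exact_mod_cast (Nat.mod_add_div (a.val + b.val) m).symm
  simp only [auxAng]
  push_cast at e ⊢
  field_simp
  linear_combination (c.val : ℝ) * e

lemma auxCos_add [NeZero m] (c a b : ZMod m) : Real.cos (auxAng c (a + b)) =
    Real.cos (auxAng c a) * Real.cos (auxAng c b) -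
      Real.sin (auxAng c a) * Real.sin (auxAng c b) := by
  obtain ⟨q, hq⟩ := auxAng_add c a b
  rw [← Real.cos_add, hq, Real.cos_add_nat_mul_two_pi]

lemma auxSin_add [NeZero m] (c a b : ZMod m) : Real.sin (auxAng c (a + b)) =
    Real.sin (auxAng c a) * Real.cos (auxAng c b) +
      Real.cos (auxAng c a) * Real.sin (auxAng c b) := by
  obtain ⟨q, hq⟩ := auxAng_add c a b
  rw [← Real.sin_add, hq, Real.sin_add_nat_mul_two_pi]

lemma auxAng_zero (c : ZMod m) : auxAng c 0 = 0 := by simp [auxAng]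

lemma auxCosSin_neg [NeZero m] (c a : ZMod m) :
    Real.cos (auxAng c (-a)) = Real.cos (auxAng c a) ∧
      Real.sin (auxAng c (-a)) = -Real.sin (auxAng c a) := by
  have h1 := auxCos_add c a (-a)
  have h2 := auxSin_add c a (-a)
  have h3 := Real.sin_sq_add_cos_sq (auxAng c a)
  rw [add_neg_cancel, auxAng_zero] at h1 h2
  simp only [Real.cos_zero, Real.sin_zero] at h1 h2
  constructor
  · linear_combination -Real.cos (auxAng c a) * h1 - Real.sin (auxAng c a) * h2 -
      Real.cos (auxAng c (-a)) * h3
  · linear_combination Real.sin (auxAng c a) * h1 - Real.cos (auxAng c a) * h2 -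
      Real.sin (auxAng c (-a)) * h3

/-- the matrices of the two-dimensional representation with character `χᵢ` -/
def auxMat (𝕜 : Type*) [RCLike 𝕜] (c : ZMod m) : DihedralGroup m → Matrix (Fin 2) (Fin 2) 𝕜
  | r a => !![(Real.cos (auxAng c a) : 𝕜), -(Real.sin (auxAng c a) : 𝕜);
      (Real.sin (auxAng c a) : 𝕜), (Real.cos (auxAng c a) : 𝕜)]
  | sr a => !![(Real.cos (auxAng c a) : 𝕜), -(Real.sin (auxAng c a) : 𝕜);
      -(Real.sin (auxAng c a) : 𝕜), -(Real.cos (auxAng c a) : 𝕜)]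

lemma auxMat_mul [NeZero m] (c : ZMod m) (g h : DihedralGroup m) :
    auxMat 𝕜 c (g * h) = auxMat 𝕜 c g * auxMat 𝕜 c h := by
  rcases g with a | a <;> rcases h with b | b <;>
    simp only [r_mul_r, r_mul_sr, sr_mul_r, sr_mul_sr, auxMat, sub_eq_add_neg, auxCos_add,
      auxSin_add, (auxCosSin_neg c _).1, (auxCosSin_neg c _).2] <;>
    ext i j <;> fin_cases i <;> fin_cases j <;>
    simp [Matrix.mul_apply, Fin.sum_univ_two] <;> ring

lemma chiChar_mem [NeZero m] (i : ℕ) (hi : 1 ≤ i ∧ 2 * i < m) :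
    chiChar 𝕜 m i ∈ irrCharacters 𝕜 (DihedralGroup m) := by
  have hm0 : (0 : ℝ) < m := by exact_mod_cast (show 0 < m by omega)
  have hival : (i : ZMod m).val = i := ZMod.val_natCast_of_lt (by omega)
  let M : DihedralGroup m →* Matrix (Fin 2) (Fin 2) 𝕜 :=
    { toFun := auxMat 𝕜 (i : ZMod m)
      map_one' := by
        rw [one_def]
        ext i j
        fin_cases i <;> fin_cases j <;> simp [auxMat, auxAng_zero]
      map_mul' := auxMat_mul _ }
  refine ⟨2, (Matrix.toLinAlgEquiv' : Matrix (Fin 2) (Fin 2) 𝕜 ≃ₐ[𝕜] _).toAlgHom.toMonoidHom.comp M,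
    auxIrr _ ?_, ?_⟩
  · intro p hp hne
    have hp' : ∀ g, ∀ v ∈ p, (auxMat 𝕜 (i : ZMod m) g).mulVec v ∈ p := fun g v hv => hp g v hv
    obtain ⟨v, hv, hv0⟩ := (Submodule.ne_bot_iff p).mp hne
    set S := Real.sin (auxAng (i : ZMod m) 1) with hS
    set C := Real.cos (auxAng (i : ZMod m) 1) with hC
    have hS0 : (S : 𝕜) ≠ 0 := by
      have h1 : (1 : ZMod m).val = 1 := by
        have := ZMod.val_natCast_of_lt (n := m) (a := 1) (by omega)
        simpa using this
      have : 0 < S := by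
        apply Real.sin_pos_of_pos_of_lt_pi
        · simp only [auxAng, hival, h1]
          have := Real.pi_pos
          have : (0 : ℝ) < i := by exact_mod_cast hi.1
          positivity
        · simp only [auxAng, hival, h1]
          rw [div_lt_iff₀ hm0]
          have h2 : (2 * i : ℝ) < m := by exact_mod_cast hi.2
          have := Real.pi_pos
          push_cast
          nlinarith
      exact_mod_cast this.ne'
    have hs : (![v 0, -v 1] : Fin 2 → 𝕜) ∈ p := by
      convert hp' (sr 0) v hv using 1
      ext j; fin_cases j <;> simp [auxMat, auxAng_zero, Matrix.mulVec, dotProduct]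
    have hrot : ∀ w ∈ p, (![C * w 0 - S * w 1, S * w 0 + C * w 1] : Fin 2 → 𝕜) ∈ p := by
      intro w hw
      convert hp' (r 1) w hw using 1
      ext j; fin_cases j <;> simp [auxMat, Matrix.mulVec, dotProduct, hS, hC]; ring
    have key : (![1, 0] : Fin 2 → 𝕜) ∈ p ∧ (![0, 1] : Fin 2 → 𝕜) ∈ p := by
      by_cases h0 : v 0 = 0
      · have h1 : v 1 ≠ 0 := fun h1 => hv0 (by ext j; fin_cases j <;> simp [h0, h1])
        have e2 : (![0, 1] : Fin 2 → 𝕜) ∈ p := by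
          convert p.smul_mem (v 1)⁻¹ hv using 1
          ext j; fin_cases j <;> simp [h0, h1]
        refine ⟨?_, e2⟩
        convert p.smul_mem (S : 𝕜)⁻¹ (p.sub_mem (p.smul_mem (C : 𝕜) e2) (hrot _ e2)) using 1
        ext j; fin_cases j <;> simp [hS0, RCLike.real_smul_eq_coe_mul]
      · have e1 : (![1, 0] : Fin 2 → 𝕜) ∈ p := by
          convert p.smul_mem (2 * v 0)⁻¹ (p.add_mem hv hs) using 1
          ext j
          fin_cases j
          · simp [Matrix.vecHead]
            field_simp
            ring
          · simp [Matrix.vecHead, Matrix.vecTail]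
        refine ⟨e1, ?_⟩
        convert p.smul_mem (S : 𝕜)⁻¹ (p.sub_mem (hrot _ e1) (p.smul_mem (C : 𝕜) e1)) using 1
        ext j; fin_cases j <;> simp [hS0, RCLike.real_smul_eq_coe_mul]
    rw [eq_top_iff]
    intro w _
    convert p.add_mem (p.smul_mem (w 0) key.1) (p.smul_mem (w 1) key.2) using 1
    ext j; fin_cases j <;> simp
  · ext g
    have : LinearMap.trace 𝕜 (Fin 2 → 𝕜) (Matrix.toLin' (auxMat 𝕜 (i : ZMod m) g)) =
        chiChar 𝕜 m i g := by
      rw [Matrix.trace_toLin'_eq]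
      rcases g with a | a <;> simp [auxMat, chiChar, Matrix.trace, auxAng, hival]
      rw [map_ofNat]
      ring
    exact this

lemma indexChar_mem [NeZero m] (δ : ℤˣ) (i : Index m) :
    indexChar 𝕜 m δ i ∈ irrCharacters 𝕜 (DihedralGroup m) := by
  rcases i with _ | _ | h | h | ⟨i, h⟩ | ⟨i, h⟩
  · exact auxLin (1 : DihedralGroup m →* 𝕜)
  · exact epsChar_mem
  · exact gammaChar_mem h δ
  · exact gammaEpsChar_mem h δ
  · exact chiChar_mem i h
  · exact chiChar_mem i h

end Aux

/-! ### The subalgebra `Q` and the morphism `θ` -/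

/-- The linear span `L{bᵢ}`. -/
abbrev dihedralSpan (m : ℕ) : Submodule ℝ ℝ[DihedralGroup m] :=
  Submodule.span ℝ (Set.range (bElt m))

/-- The `bᵢ` form a basis of their span. -/
def dihedralBasis (m : ℕ) [NeZero m] : Module.Basis (Index m) ℝ (dihedralSpan m) :=
  Module.Basis.span (bElt_indep (NeZero.pos m))

/-- The linear map `L{bᵢ} → (D_m → 𝕜)` with `bᵢ ↦ χ⁽ⁱ⁾`. -/
def thetaLin (𝕜 : Type*) [RCLike 𝕜] (m : ℕ) [NeZero m] (δ : ℤˣ) :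
    dihedralSpan m →ₗ[ℝ] (DihedralGroup m → 𝕜) :=
  (dihedralBasis m).constr ℝ (indexChar 𝕜 m δ)

section Aux

set_option linter.unusedSectionVars false

variable {m : ℕ} [NeZero m] {𝕜 : Type*} [RCLike 𝕜] {δ : ℤˣ}

/-- `x` lies in the span of the `bᵢ` and is mapped to `X`. -/
def auxMaps (δ : ℤˣ) (x : ℝ[DihedralGroup m]) (X : DihedralGroup m → 𝕜) : Prop :=
  ∃ h : x ∈ dihedralSpan m, thetaLin 𝕜 m δ ⟨x, h⟩ = X

lemma auxMaps_b (i : Index m) : auxMaps δ (bElt m i) (indexChar 𝕜 m δ i) := by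
  have h : bElt m i ∈ dihedralSpan m := Submodule.subset_span ⟨i, rfl⟩
  refine ⟨h, ?_⟩
  have e : (⟨bElt m i, h⟩ : dihedralSpan m) = dihedralBasis m i :=
    (Module.Basis.span_apply (bElt_indep (NeZero.pos m)) i).symm
  rw [thetaLin, e, Module.Basis.constr_basis]

lemma auxMaps_add {x y : ℝ[DihedralGroup m]} {X Y : DihedralGroup m → 𝕜}
    (hx : auxMaps δ x X) (hy : auxMaps δ y Y) : auxMaps δ (x + y) (X + Y) := by
  obtain ⟨hx, ex⟩ := hx
  obtain ⟨hy, ey⟩ := hy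
  refine ⟨Submodule.add_mem _ hx hy, ?_⟩
  rw [← ex, ← ey, ← map_add]
  rfl

lemma auxMaps_smul (t : ℝ) {x : ℝ[DihedralGroup m]} {X : DihedralGroup m → 𝕜}
    (hx : auxMaps δ x X) : auxMaps δ (t • x) (t • X) := by
  obtain ⟨hx, ex⟩ := hx
  refine ⟨Submodule.smul_mem _ t hx, ?_⟩
  rw [← ex, ← map_smul]
  rfl

lemma auxMaps_zero : auxMaps δ (0 : ℝ[DihedralGroup m]) (0 : DihedralGroup m → 𝕜) :=
  ⟨Submodule.zero_mem _, map_zero (thetaLin 𝕜 m δ)⟩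

lemma auxMaps_unique {x : ℝ[DihedralGroup m]} {X Y : DihedralGroup m → 𝕜}
    (hx : auxMaps δ x X) (hy : auxMaps δ x Y) : X = Y := by
  obtain ⟨hx, ex⟩ := hx
  obtain ⟨hy, ey⟩ := hy
  rw [← ex, ← ey]

/-- the image of `auxE c`, for `2c = 0` -/
def auxL (𝕜 : Type*) [RCLike 𝕜] (δ : ℤˣ) (c : ZMod m) : DihedralGroup m → 𝕜
  | r a => (Real.cos (auxAng c a) : 𝕜)
  | sr a => if c = 0 then 1 else (Real.cos (auxAng c a) : 𝕜) * ((δ : ℤ) : 𝕜)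

/-- the image of `auxY c` -/
def auxX (𝕜 : Type*) [RCLike 𝕜] (c : ZMod m) : DihedralGroup m → 𝕜
  | r a => 2 * (Real.cos (auxAng c a) : 𝕜)
  | sr _ => 0

lemma auxHalf {c : ZMod m} (h : c + c = 0) (h0 : c ≠ 0) :
    Even m ∧ c = ((m / 2 : ℕ) : ZMod m) ∧ c.val = m / 2 := by
  have h1 : c.val + c.val = m := by
    have h2 : (c.val + c.val) % m = 0 := by rw [← ZMod.val_add, h, ZMod.val_zero]
    have h3 := ZMod.val_lt c
    have h4 : c.val ≠ 0 := fun h => h0 ((ZMod.val_eq_zero c).mp h)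
    obtain ⟨q, hq⟩ := Nat.dvd_of_mod_eq_zero h2
    have : q = 1 := by
      rcases q with _ | _ | q
      · omega
      · rfl
      · nlinarith
    rw [hq, this, mul_one]
  have h5 : c.val = m / 2 := by omega
  exact ⟨⟨c.val, h1.symm⟩, by rw [← h5, ZMod.natCast_zmod_val], h5⟩

lemma auxCos_half {c : ZMod m} (h : c + c = 0) (h0 : c ≠ 0) (a : ZMod m) :
    Real.cos (auxAng c a) = (-1) ^ a.val := by
  obtain ⟨⟨k, hk⟩, -, hv⟩ := auxHalf h h0
  have hm : (m : ℝ) ≠ 0 := Nat.cast_ne_zero.mpr (NeZero.ne m)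
  have : auxAng c a = a.val * Real.pi := by
    rw [auxAng, hv, show m / 2 = k by omega]
    have : (m : ℝ) = k + k := by exact_mod_cast hk
    field_simp
    rw [this]; ring
  rw [this, Real.cos_nat_mul_pi]

lemma auxSin_half {c : ZMod m} (h : c + c = 0) (a : ZMod m) : Real.sin (auxAng c a) = 0 := by
  have h1 := (auxCosSin_neg a c).2
  rw [neg_eq_of_add_eq_zero_left h, auxAng_comm] at h1
  linarith

lemma auxL_zero : auxL 𝕜 δ (0 : ZMod m) = 1 := by
  ext (a | a) <;> simp [auxL, auxAng]

lemma auxL_half {c : ZMod m} (h : c + c = 0) (h0 : c ≠ 0) :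
    auxL 𝕜 δ c = gammaChar 𝕜 m δ := by
  ext (a | a) <;> simp [auxL, h0, auxCos_half h h0, gammaChar]

lemma auxEps_sq : epsChar 𝕜 m * epsChar 𝕜 m = 1 := by
  ext (a | a) <;> simp [epsChar]

lemma auxL_mul {c d : ZMod m} (hc : c + c = 0) (hd : d + d = 0) :
    auxL 𝕜 δ c * auxL 𝕜 δ d = auxL 𝕜 δ (c + d) := by
  by_cases h0 : c = 0
  · subst h0; rw [auxL_zero, one_mul, zero_add]
  by_cases h1 : d = 0
  · subst h1; rw [auxL_zero, mul_one, add_zero]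
  have : c = d := (auxHalf hc h0).2.1.trans (auxHalf hd h1).2.1.symm
  subst this
  rw [hc, auxL_zero, auxL_half hc h0]
  have hδ := auxDelta (𝕜 := 𝕜) δ
  ext (a | a) <;> simp only [gammaChar, Pi.mul_apply, Pi.one_apply] <;>
    rcases neg_one_pow_eq_or 𝕜 a.val with h | h <;> rw [h] <;> first | ring1 | linear_combination hδ

lemma auxX_mul_L {c d : ZMod m} (hd : d + d = 0) :
    auxX 𝕜 c * auxL 𝕜 δ d = auxX 𝕜 (c + d) := by
  ext (a | a)
  · simp only [auxX, auxL, Pi.mul_apply]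
    rw [auxAng_comm (c + d), auxCos_add, auxAng_comm a d, auxSin_half hd, auxAng_comm a c]
    push_cast; ring
  · simp [auxX]

lemma auxX_mul_eps (c : ZMod m) : auxX 𝕜 c * epsChar 𝕜 m = auxX 𝕜 c := by
  ext (a | a) <;> simp [auxX, epsChar]

lemma auxX_neg (c : ZMod m) : auxX 𝕜 (-c) = auxX 𝕜 c := by
  ext (a | a)
  · simp only [auxX]
    rw [auxAng_comm, (auxCosSin_neg a c).1, auxAng_comm]
  · rfl

lemma auxX_mul (c d : ZMod m) : auxX 𝕜 c * auxX 𝕜 d = auxX 𝕜 (c + d) + auxX 𝕜 (d - c) := by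
  ext (a | a)
  · simp only [auxX, Pi.mul_apply, Pi.add_apply]
    rw [auxAng_comm (c + d), auxAng_comm (d - c), sub_eq_add_neg, auxCos_add, auxCos_add,
      (auxCosSin_neg a c).1, (auxCosSin_neg a c).2, auxAng_comm a d, auxAng_comm a c]
    push_cast; ring
  · simp [auxX]

lemma auxX_nat (i : ℕ) (hi : i < m) : auxX 𝕜 (i : ZMod m) = chiChar 𝕜 m i := by
  ext (a | a)
  · simp [auxX, chiChar, auxAng, ZMod.val_natCast_of_lt hi]
    exact Or.inl (map_ofNat (algebraMap ℝ 𝕜) 2).symm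
  · rfl

lemma auxMaps_E {c : ZMod m} (h : c + c = 0) : auxMaps δ (auxE c) (auxL 𝕜 δ c) := by
  by_cases h0 : c = 0
  · subst h0
    rw [auxL_zero]
    exact auxMaps_b .e
  · obtain ⟨hm, hc, -⟩ := auxHalf h h0
    rw [auxL_half h h0, hc]
    exact auxMaps_b (.rk hm)

lemma auxMaps_T {c : ZMod m} (h : c + c = 0) :
    auxMaps δ (auxT c) (auxL 𝕜 δ c * epsChar 𝕜 m) := by
  by_cases h0 : c = 0
  · subst h0
    rw [auxL_zero, one_mul, ← bElt_rs]
    exact auxMaps_b .rs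
  · obtain ⟨hm, hc, -⟩ := auxHalf h h0
    rw [auxL_half h h0, hc, ← bElt_rks hm]
    exact auxMaps_b (.rks hm)

lemma auxMaps_Y (c : ZMod m) : auxMaps δ (auxY c) (auxX 𝕜 c) := by
  by_cases h : c + c = 0
  · have e1 : auxY c = auxE c + auxT c := by
      have : c = -c := eq_neg_of_add_eq_zero_left h
      rw [auxY, auxE, auxT]
      congr 3
      linear_combination h
    have e2 : auxX 𝕜 c = auxL 𝕜 δ c + auxL 𝕜 δ c * epsChar 𝕜 m := by
      ext (a | a) <;> simp [auxX, auxL, epsChar]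
      ring
    rw [e1, e2]
    exact auxMaps_add (auxMaps_E h) (auxMaps_T h)
  · have hlt := ZMod.val_lt c
    have h0 : c.val ≠ 0 := fun h0 => h (by rw [(ZMod.val_eq_zero c).mp h0, add_zero])
    have h1 : c.val + c.val ≠ m := fun h1 => h (by
      rw [← ZMod.natCast_zmod_val c, ← Nat.cast_add, h1, ZMod.natCast_self])
    by_cases h2 : 2 * c.val < m
    · have h3 := auxMaps_b (𝕜 := 𝕜) (δ := δ) (.y c.val ⟨by omega, h2⟩)
      rw [bElt_y, ZMod.natCast_zmod_val] at h3
      convert h3 using 1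
      rw [indexChar, ← auxX_nat _ hlt, ZMod.natCast_zmod_val]
    · have h3 := auxMaps_b (𝕜 := 𝕜) (δ := δ) (.yrs (m := m) (m - c.val) ⟨by omega, by omega⟩)
      rw [bElt_yrs, auxCast_sub hlt.le, ZMod.natCast_zmod_val, neg_neg] at h3
      convert h3 using 1
      rw [indexChar, ← auxX_nat (m := m) (m - c.val) (by omega), auxCast_sub hlt.le, ZMod.natCast_zmod_val, auxX_neg]

lemma auxForm (δ : ℤˣ) (i : Index m) :
    (∃ c : ZMod m, c + c = 0 ∧ bElt m i = auxE c ∧ indexChar 𝕜 m δ i = auxL 𝕜 δ c) ∨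
    (∃ c : ZMod m, c + c = 0 ∧ bElt m i = auxT c ∧
      indexChar 𝕜 m δ i = auxL 𝕜 δ c * epsChar 𝕜 m) ∨
    (∃ c : ZMod m, bElt m i = auxY c ∧ indexChar 𝕜 m δ i = auxX 𝕜 c) := by
  have hk : ∀ h : Even m, ((m / 2 : ℕ) : ZMod m) + ((m / 2 : ℕ) : ZMod m) = 0 ∧
      ((m / 2 : ℕ) : ZMod m) ≠ 0 := by
    intro h
    have hm := NeZero.pos m
    have h2 := even_iff_two_dvd.mp h
    constructor
    · rw [← Nat.cast_add, show m / 2 + m / 2 = m by omega, ZMod.natCast_self]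
    · exact fun h => auxPos (by omega) (by omega) h
  rcases i with _ | _ | h | h | ⟨i, h⟩ | ⟨i, h⟩
  · exact Or.inl ⟨0, add_zero _, bElt_e, by rw [auxL_zero]; rfl⟩
  · exact Or.inr (Or.inl ⟨0, add_zero _, bElt_rs, by rw [auxL_zero, one_mul]; rfl⟩)
  · exact Or.inl ⟨_, (hk h).1, bElt_rk h, by rw [auxL_half (hk h).1 (hk h).2]; rfl⟩
  · exact Or.inr (Or.inl ⟨_, (hk h).1, bElt_rks h, by
      rw [auxL_half (hk h).1 (hk h).2]; rfl⟩)
  · exact Or.inr (Or.inr ⟨_, bElt_y i h, by rw [auxX_nat i (by omega)]; rfl⟩)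
  · exact Or.inr (Or.inr ⟨_, bElt_yrs i h, by rw [auxX_neg, auxX_nat i (by omega)]; rfl⟩)

lemma auxMaps_mul (i j : Index m) : auxMaps δ (bElt m i * bElt m j)
    (indexChar 𝕜 m δ i * indexChar 𝕜 m δ j) := by
  have hs : ∀ {c d : ZMod m}, c + c = 0 → d + d = 0 → (c + d) + (c + d) = 0 := by
    intro c d hc hd; linear_combination hc + hd
  rcases auxForm (𝕜 := 𝕜) δ i with ⟨c, hc, e1, f1⟩ | ⟨c, hc, e1, f1⟩ | ⟨c, e1, f1⟩ <;>
  rcases auxForm (𝕜 := 𝕜) δ j with ⟨d, hd, e2, f2⟩ | ⟨d, hd, e2, f2⟩ | ⟨d, e2, f2⟩ <;>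
  rw [e1, e2, f1, f2]
  · convert auxMaps_E (δ := δ) (hs hc hd) using 1
    · simp [auxE]
    · rw [auxL_mul hc hd]
  · convert auxMaps_T (δ := δ) (hs hc hd) using 1
    · simp only [auxE, auxT, MonoidAlgebra.single_mul_single, r_mul_sr, mul_one]
      congr 2; ring
    · rw [← auxL_mul hc hd, mul_assoc]
  · convert auxMaps_Y (δ := δ) (d + c) using 1
    · simp only [auxE, auxY, MonoidAlgebra.single_mul_single, r_mul_sr, r_mul_r, mul_one, mul_add]
      congr 3 <;> first | ring1 | linear_combination -hc
    · rw [mul_comm, auxX_mul_L hc]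
  · convert auxMaps_T (δ := δ) (hs hc hd) using 1
    · simp only [auxE, auxT, MonoidAlgebra.single_mul_single, sr_mul_r, mul_one]
      congr 2; linear_combination hd
    · rw [← auxL_mul hc hd]; ring
  · convert auxMaps_E (δ := δ) (hs hc hd) using 1
    · simp only [auxE, auxT, MonoidAlgebra.single_mul_single, sr_mul_sr, mul_one]
      congr 2; linear_combination -hd
    · rw [← auxL_mul hc hd]
      linear_combination auxL 𝕜 δ c * auxL 𝕜 δ d * auxEps_sq (𝕜 := 𝕜) (m := m)
  · convert auxMaps_Y (δ := δ) (d + c) using 1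
    · simp only [auxT, auxY, MonoidAlgebra.single_mul_single, sr_mul_r, sr_mul_sr, mul_one, mul_add]
      rw [add_comm]
      congr 3 <;> first | ring1 | linear_combination -hc
    · rw [mul_assoc, mul_comm (epsChar 𝕜 m), auxX_mul_eps, mul_comm, auxX_mul_L hc]
  · convert auxMaps_Y (δ := δ) (c + d) using 1
    · simp only [auxE, auxY, MonoidAlgebra.single_mul_single, r_mul_r, sr_mul_r, mul_one, add_mul]
      congr 3; ring
    · rw [auxX_mul_L hd]
  · convert auxMaps_Y (δ := δ) (-(c + d)) using 1
    · simp only [auxT, auxY, MonoidAlgebra.single_mul_single, r_mul_sr, sr_mul_sr, mul_one, add_mul]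
      rw [add_comm]
      congr 3 <;> ring
    · rw [auxX_neg, ← auxX_mul_L hd, ← mul_assoc, auxX_mul_L hd, auxX_mul_eps]
  · convert auxMaps_add (δ := δ) (auxMaps_Y (𝕜 := 𝕜) (c + d)) (auxMaps_Y (d - c)) using 1
    · simp only [auxY, MonoidAlgebra.single_mul_single, r_mul_sr, sr_mul_sr, sr_mul_r, r_mul_r,
        mul_one, add_mul, mul_add]
      rw [show d - 1 - (c - 1) = d - c by ring, show c - 1 + d = c + d - 1 by ring,
        show d - 1 - c = d - c - 1 by ring]
      abel
    · rw [auxX_mul]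

lemma auxMaps_mul' {x y : ℝ[DihedralGroup m]} (hx : x ∈ dihedralSpan m)
    (hy : y ∈ dihedralSpan m) : ∃ X Y : DihedralGroup m → 𝕜,
      auxMaps δ x X ∧ auxMaps δ y Y ∧ auxMaps δ (x * y) (X * Y) := by
  obtain ⟨Y, hY⟩ : ∃ Y : DihedralGroup m → 𝕜, auxMaps δ y Y := ⟨_, hy, rfl⟩
  have step : ∀ i, auxMaps δ (bElt m i * y) (indexChar 𝕜 m δ i * Y) := by
    intro i
    have : ∃ Z, auxMaps δ y Z ∧ auxMaps δ (bElt m i * y) (indexChar 𝕜 m δ i * Z) := by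
      clear hY
      induction hy using Submodule.span_induction with
      | mem z hz =>
        obtain ⟨j, rfl⟩ := hz
        exact ⟨_, auxMaps_b j, auxMaps_mul i j⟩
      | zero => exact ⟨0, auxMaps_zero, by simpa using auxMaps_zero⟩
      | add a b _ _ ha hb =>
        obtain ⟨A, ha, ha'⟩ := ha
        obtain ⟨B, hb, hb'⟩ := hb
        exact ⟨A + B, auxMaps_add ha hb, by simpa only [mul_add] using auxMaps_add ha' hb'⟩
      | smul t a _ ha =>
        obtain ⟨A, ha, ha'⟩ := ha
        exact ⟨t • A, auxMaps_smul t ha, by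
          simpa only [mul_smul_comm] using auxMaps_smul t ha'⟩
    obtain ⟨Z, h1, h2⟩ := this
    rwa [auxMaps_unique hY h1]
  suffices ∃ X, auxMaps δ x X ∧ auxMaps δ (x * y) (X * Y) by
    obtain ⟨X, h1, h2⟩ := this
    exact ⟨X, Y, h1, hY, h2⟩
  induction hx using Submodule.span_induction with
  | mem z hz =>
    obtain ⟨i, rfl⟩ := hz
    exact ⟨_, auxMaps_b i, step i⟩
  | zero => exact ⟨0, auxMaps_zero, by simpa using auxMaps_zero⟩
  | add a b _ _ ha hb =>
    obtain ⟨A, ha, ha'⟩ := ha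
    obtain ⟨B, hb, hb'⟩ := hb
    exact ⟨A + B, auxMaps_add ha hb, by simpa only [add_mul] using auxMaps_add ha' hb'⟩
  | smul t a _ ha =>
    obtain ⟨A, ha, ha'⟩ := ha
    exact ⟨t • A, auxMaps_smul t ha, by
      simpa only [smul_mul_assoc] using auxMaps_smul t ha'⟩

end Aux

lemma bElt_mem_span {m : ℕ} (i : Index m) : bElt m i ∈ dihedralSpan m :=
  Submodule.subset_span ⟨i, rfl⟩

/-- The subalgebra `Q = L{bᵢ}` of the group algebra. -/
def dihedralQ (m : ℕ) [NeZero m] : Subalgebra ℝ ℝ[DihedralGroup m] :=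
  (dihedralSpan m).toSubalgebra (bElt_mem_span .e) fun _ _ hx hy => by
    obtain ⟨X, Y, -, -, h⟩ := auxMaps_mul' (𝕜 := ℝ) (δ := 1) hx hy
    exact h.1

lemma bElt_mem {m : ℕ} [NeZero m] (i : Index m) : bElt m i ∈ dihedralQ m := bElt_mem_span i

lemma thetaLin_b {𝕜 : Type*} [RCLike 𝕜] {m : ℕ} [NeZero m] (δ : ℤˣ) (i : Index m) :
    thetaLin 𝕜 m δ ⟨bElt m i, bElt_mem_span i⟩ = indexChar 𝕜 m δ i :=
  (auxMaps_b i).2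

lemma thetaLin_mem {𝕜 : Type*} [RCLike 𝕜] {m : ℕ} [NeZero m] (δ : ℤˣ) (f : dihedralSpan m) :
    thetaLin 𝕜 m δ f ∈ characterAlgebra 𝕜 (DihedralGroup m) := by
  rw [thetaLin, Module.Basis.constr_apply_fintype]
  exact sum_mem fun i _ => Subalgebra.smul_mem _ (Algebra.subset_adjoin (indexChar_mem δ i)) _

/-- The algebra morphism `θ : Q → ℝ Irr(D_m)` with `θ(bᵢ) = χ⁽ⁱ⁾`. -/
def theta (𝕜 : Type*) [RCLike 𝕜] (m : ℕ) [NeZero m] (δ : ℤˣ) :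
    dihedralQ m →ₐ[ℝ] characterAlgebra 𝕜 (DihedralGroup m) where
  toFun f := ⟨thetaLin 𝕜 m δ ⟨f.1, f.2⟩, thetaLin_mem δ _⟩
  map_one' := Subtype.ext (thetaLin_b δ .e)
  map_mul' f g := Subtype.ext <| by
    obtain ⟨X, Y, ⟨_, h1⟩, ⟨_, h2⟩, ⟨_, h3⟩⟩ := auxMaps_mul' (𝕜 := 𝕜) (δ := δ) f.2 g.2
    change thetaLin 𝕜 m δ ⟨f.1 * g.1, _⟩ =
      thetaLin 𝕜 m δ ⟨f.1, f.2⟩ * thetaLin 𝕜 m δ ⟨g.1, g.2⟩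
    rw [h1, h2, h3]
  map_zero' := Subtype.ext auxMaps_zero.2
  map_add' f g := Subtype.ext (auxMaps_add ⟨f.2, rfl⟩ ⟨g.2, rfl⟩).2
  commutes' t := Subtype.ext <| by
    have h := (auxMaps_smul t (auxMaps_b (𝕜 := 𝕜) (m := m) (δ := δ) .e)).2
    have e : algebraMap ℝ ℝ[DihedralGroup m] t = t • bElt m .e := by
      rw [Algebra.algebraMap_eq_smul_one]; rfl
    change thetaLin 𝕜 m δ ⟨algebraMap ℝ ℝ[DihedralGroup m] t, _⟩ = algebraMap ℝ _ t
    simp only [e]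
    rw [h, Algebra.algebraMap_eq_smul_one]
    rfl

/-- The elements `bᵢ` of `Q`. -/
def b {m : ℕ} [NeZero m] (i : Index m) : dihedralQ m := ⟨bElt m i, bElt_mem i⟩

lemma theta_b {𝕜 : Type*} [RCLike 𝕜] {m : ℕ} [NeZero m] (δ : ℤˣ) (i : Index m) :
    (theta 𝕜 m δ (b i) : DihedralGroup m → 𝕜) = indexChar 𝕜 m δ i :=
  thetaLin_b δ i

end DihedralWords

end

noncomputable section
namespace DihedralWords
open DihedralGroup

/-! ### Multiplicities and characters -/

/-! The character of `V^{⊗d}` is the `d`-th power of the character of `V`, hence equals `θ(f)^d =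
θ(f^d)` because `θ` is multiplicative. Expanding `f^d` in the basis `bᵢ` therefore writes this
character as a real combination of the irreducible characters `θ(bᵢ)`, and two facts about its
coefficients finish the proof.

First, the coefficients count words. The `bᵢ` have pairwise disjoint supports with all coefficients
equal to 1, so the coordinate of `f^d` along `bᵢ` is its coefficient at any `σᵢ` in `supp bᵢ`
(`eq_sum_coeff_smul_b`). Multiplying out `f^d` shows that this coefficient is the weighted count of
words reducing to `σᵢ` (`sum_words`).

Second, the coefficients determine multiplicities (`simpleMultiplicity_eq_sum`). Pairing a character
with that of a simple module gives the dimension of a Hom space, and distinct irreducible characters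
are orthogonal. The pairing of a simple character with itself is the dimension `D` of its
endomorphism algebra, and `D` also divides out of the Hom count, so no algebraically closed field is
needed. Neither independence of the `θ(bᵢ)` nor their exhausting the irreducible characters is used:
coincidences such as `θ(yᵢ) = θ(yᵢrs)` are absorbed by summing over equal characters. -/

/-- Maps out of a simple module land in the isotypic component, so the length of the latter counts
them. -/
lemma length_isotypicComponent_mul_finrank {k A S W : Type*} [Field k] [Ring A] [Algebra k A]
    [AddCommGroup S] [Module k S] [Module A S] [IsScalarTower k A S]
    [AddCommGroup W] [Module k W] [Module A W] [IsScalarTower k A W]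
    [Module.Finite k S] [Module.Finite k W] [IsSimpleModule A S] :
    (Module.length A (isotypicComponent A W S)).toNat * Module.finrank k (S →ₗ[A] S) =
      Module.finrank k (S →ₗ[A] W) := by
  have : IsNoetherian A W := isNoetherian_of_tower k inferInstance
  obtain ⟨n, ⟨e⟩⟩ := (IsIsotypicOfType.isotypicComponent A W S).linearEquiv_fun
  have hn : (Module.length A (isotypicComponent A W S)).toNat = n := by
    rw [e.length_eq, Module.length_pi_of_fintype]
    simp [Module.length_eq_one]
  -- Module maps preserve isotypic components, and `S` is all of its own.
  have hmem (φ : S →ₗ[A] W) (x : S) : φ x ∈ isotypicComponent A W S := by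
    have h := φ.le_comap_isotypicComponent S
    exact h ((le_sSup ⟨Submodule.topEquiv⟩ : (⊤ : Submodule A S) ≤ isotypicComponent A S S) trivial)
  let E : (S →ₗ[A] W) ≃ₗ[k] (Fin n → (S →ₗ[A] S)) :=
    { toFun φ i := LinearMap.proj i ∘ₗ e.toLinearMap ∘ₗ φ.codRestrict _ (hmem φ)
      invFun ψ := (isotypicComponent A W S).subtype ∘ₗ e.symm.toLinearMap ∘ₗ LinearMap.pi ψ
      map_add' φ ψ := by
        ext i x
        simp only [LinearMap.comp_apply, Pi.add_apply, LinearMap.add_apply]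
        rw [← map_add, ← map_add]; rfl
      map_smul' c φ := by
        ext i x
        change e _ i = c • e _ i
        -- `e` is only known to be `A`-linear, so the scalar `c` is moved through it as an element
        -- of `A`.
        rw [← algebraMap_smul A c (e _ i), ← Pi.smul_apply, ← map_smul]
        exact congrArg (fun z => e z i) (Subtype.ext (algebraMap_smul A c (φ x)).symm)
      left_inv φ := by
        ext x
        change ((e.symm (e _) : isotypicComponent A W S) : W) = _
        rw [e.symm_apply_apply]; rfl
      right_inv ψ := by
        ext i x
        exact congrFun (e.apply_symm_apply fun i => ψ i x) i }
  have : Module.Finite k (S →ₗ[A] S) :=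
    .of_injective (LinearMap.restrictScalarsₗ k A S S k) (LinearMap.restrictScalars_injective k)
  rw [E.finrank_eq, hn, Module.finrank_pi_fintype]
  simp

section Multiplicity

variable {𝕜 : Type*} [RCLike 𝕜] {G : Type*} [Group G]
  {S W : Type*} [AddCommGroup S] [Module 𝕜 S] [AddCommGroup W] [Module 𝕜 W]

/-- Each copy of the simple module in the isotypic component contributes one copy of its
endomorphism algebra to Hom. The factor cannot be dropped in general, since over ℝ that algebra may
have dimension greater than 1. -/
lemma simpleMultiplicity_mul_finrank [FiniteDimensional 𝕜 S] [FiniteDimensional 𝕜 W]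
    (τ : Representation 𝕜 G S) (ρ : Representation 𝕜 G W) (hτ : τ.IsIrreducible) :
    simpleMultiplicity τ ρ * Module.finrank 𝕜 (τ.IntertwiningMap τ) =
      Module.finrank 𝕜 (τ.IntertwiningMap ρ) := by
  have := (Representation.irreducible_iff_isSimpleModule_asModule τ).mp hτ
  rw [(Representation.IntertwiningMap.equivLinearMapAsModule τ τ).finrank_eq,
    (Representation.IntertwiningMap.equivLinearMapAsModule τ ρ).finrank_eq]
  exact length_isotypicComponent_mul_finrank

/-- The multiplicity of a simple module, computed from a decomposition of the character as a
combination of irreducible characters. -/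
lemma simpleMultiplicity_eq_sum [Finite G] [FiniteDimensional 𝕜 S] [FiniteDimensional 𝕜 W]
    (τ : Representation 𝕜 G S) (ρ : Representation 𝕜 G W) (hτ : τ.IsIrreducible)
    {ι : Type*} [Fintype ι] (χ : ι → G → 𝕜) (hχ : ∀ i, χ i ∈ irrCharacters 𝕜 G) (c : ι → ℝ)
    (h : ρ.character = ∑ i, c i • χ i) [DecidablePred fun i => χ i = τ.character] :
    (simpleMultiplicity τ ρ : ℝ) = ∑ i with χ i = τ.character, c i := by
  have := Fintype.ofFinite G
  let : Invertible (Nat.card G : 𝕜) := invertibleOfNonzero (by simp)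
  set D := Module.finrank 𝕜 (τ.IntertwiningMap τ) with hD
  have hfin : Module.Finite 𝕜 (τ.IntertwiningMap τ) :=
    .of_injective (Representation.IntertwiningMap.toLinearMapl τ τ)
      fun _ _ h => Representation.IntertwiningMap.ext h
  -- The identity is a nonzero intertwiner; this is what allows `D` to be cancelled at the end.
  have hD0 : D ≠ 0 := by
    obtain ⟨v, hv⟩ : ∃ v : S, v ≠ 0 := by
      have := (Representation.irreducible_iff_isSimpleModule_asModule τ).mp hτ
      have := IsSimpleModule.nontrivial 𝕜[G] τ.asModule
      exact exists_ne (0 : τ.asModule)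
    refine (Module.finrank_pos_iff_exists_ne_zero.mpr ⟨.id τ, fun h0 => hv ?_⟩).ne'
    simpa using congrArg (fun φ : τ.IntertwiningMap τ => φ v) h0
  -- Schur orthogonality. A nonzero map between irreducibles is an isomorphism and would force equal
  -- characters, so different characters already give a zero Hom space.
  have inner (i : ι) : (Nat.card G : 𝕜)⁻¹ * ∑ g, χ i g * τ.character g⁻¹ =
      if χ i = τ.character then (D : 𝕜) else 0 := by
    split_ifs with hi
    · rw [hi, Representation.card_inv_mul_sum_char_mul_char_eq_finrank]
    · obtain ⟨n, π, hπ, hc⟩ := hχ i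
      have : Subsingleton (τ.IntertwiningMap π) := by
        refine subsingleton_of_forall_eq 0 fun φ =>
          (Representation.IsIrreducible.bijective_or_eq_zero φ).resolve_left fun hb => hi ?_
        rw [← hc, Representation.char_iso (φ.ofBijective hb)]
      rw [← hc, Representation.card_inv_mul_sum_char_mul_char_eq_finrank,
        Module.finrank_zero_of_subsingleton, Nat.cast_zero]
  -- Both sides compute the dimension of Hom from `τ` to `ρ`: the left through the isotypic
  -- component, the right by linearity of the pairing in the character of `ρ`.
  have key : (simpleMultiplicity τ ρ * D : 𝕜) = (∑ i with χ i = τ.character, (c i : 𝕜)) * D := by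
    rw [hD, ← Nat.cast_mul, simpleMultiplicity_mul_finrank τ ρ hτ,
      ← Representation.card_inv_mul_sum_char_mul_char_eq_finrank, h]
    simp only [Finset.sum_apply, Pi.smul_apply, RCLike.real_smul_eq_coe_mul, Finset.sum_mul]
    rw [Finset.sum_comm, Finset.mul_sum, Finset.sum_filter]
    refine Finset.sum_congr rfl fun i _ => ?_
    simp only [mul_assoc]
    rw [← Finset.mul_sum, mul_left_comm, inner i]
    split_ifs <;> simp [hD]
  have := mul_right_cancel₀ (Nat.cast_ne_zero.mpr hD0) key
  exact_mod_cast this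

end Multiplicity

/-! ### Characters of tensor powers -/

/-- In the product basis, a diagonal entry of the tensor product map is a product of diagonal
entries of the factors, and summing over all multi-indices is the expansion of a product of sums. -/
lemma trace_piTensorProduct_map {R M ι : Type*} [CommRing R] [AddCommGroup M] [Module R M]
    [Module.Free R M] [Module.Finite R M] [Fintype ι] (f : ι → M →ₗ[R] M) :
    LinearMap.trace R _ (PiTensorProduct.map f) = ∏ i, LinearMap.trace R M (f i) := by
  classical
  let b := Module.Free.chooseBasis R M
  simp_rw [LinearMap.trace_eq_matrix_trace R (Basis.piTensorProduct fun _ : ι => b),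
    LinearMap.trace_eq_matrix_trace R b, Matrix.trace, Finset.prod_univ_sum]
  rw [Fintype.piFinset_univ]
  refine Finset.sum_congr rfl fun p _ => ?_
  simp [LinearMap.toMatrix_apply]

lemma character_tensorPower {𝕜 : Type*} [RCLike 𝕜] {G : Type*} [Group G] {V : Type*}
    [AddCommGroup V] [Module 𝕜 V] [FiniteDimensional 𝕜 V] (ρ : Representation 𝕜 G V) (d : ℕ) :
    (tensorPower ρ d).character = ρ.character ^ d := by
  ext g
  exact (trace_piTensorProduct_map fun _ : Fin d => ρ g).trans (by
    simp [Representation.character])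

/-! ### Words and powers in the group algebra -/

section Words

variable {G : Type*} [Group G]

/-- Traversing an edge is right multiplication by its label, so the endpoint is the start times the
product of the word. The start stays general because it moves in the induction. -/
lemma cayleyPath_iff {A : Set G} {g h : G} {w : List G} :
    CayleyPath A g w h ↔ (∀ a ∈ w, a ∈ A) ∧ g * w.prod = h := by
  induction w generalizing g with
  | nil =>
    constructor
    · rintro ⟨⟩; simp
    · rintro ⟨-, h⟩
      rw [List.prod_nil, mul_one] at h
      exact h ▸ .nil g
  | cons a w ih =>
    constructor
    · rintro (_ | ⟨⟨ha, rfl⟩, hp⟩)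
      obtain ⟨h1, h2⟩ := ih.mp hp
      exact ⟨by simpa [ha] using h1, by rw [List.prod_cons, ← mul_assoc, h2]⟩
    · rintro ⟨h1, h2⟩
      rw [List.forall_mem_cons] at h1
      exact .cons ⟨h1.1, rfl⟩ (ih.mpr ⟨h1.2, by rw [mul_assoc, ← List.prod_cons, h2]⟩)

variable [Fintype G]

/-- Multiplying out `f^d` gives one term for each choice of a letter in each factor; the induction
splits off the first letter. -/
lemma coeff_pow [DecidableEq G] (f : ℝ[G]) (d : ℕ) (σ : G) :
    (f ^ d).coeff σ = ∑ w : Fin d → G, if (List.ofFn w).prod = σ then wordWeight f.coeff w else 0 := by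
  induction d generalizing σ with
  | zero => simp [wordWeight, MonoidAlgebra.one_def, Finsupp.single_apply]
  | succ d ih =>
    rw [pow_succ', ← (Fin.consEquiv fun _ : Fin (d + 1) => G).sum_comp, Fintype.sum_prod_type]
    have hf : f = ∑ a, MonoidAlgebra.single a (f.coeff a) := by
      ext g; simp
    conv_lhs => rw [hf, Finset.sum_mul]
    simp only [MonoidAlgebra.coeff_sum, Finsupp.finsetSum_apply,
      MonoidAlgebra.coeff_single_mul_apply]
    -- The expansion also replaced `f` inside the remaining power and is undone there, so that `ih`
    -- applies at `a⁻¹ * σ`.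
    rw [← hf]
    refine Finset.sum_congr rfl fun a _ => ?_
    rw [ih, Finset.mul_sum]
    refine Finset.sum_congr rfl fun w _ => ?_
    simp [Fin.consEquiv, wordWeight, Fin.prod_univ_succ, eq_inv_mul_iff_mul_eq]

/-- A word with a letter outside the support has weight 0, so restricting to paths in the Cayley
graph loses nothing from the expansion of `f^d`. -/
lemma sum_words (f : ℝ[G]) (d : ℕ) (σ : G) :
    ∑ w ∈ words (supp f) d σ, wordWeight f.coeff w = (f ^ d).coeff σ := by
  classical
  rw [coeff_pow, words, Finset.sum_filter]
  refine Finset.sum_congr rfl fun w _ => ?_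
  simp only [cayleyPath_iff, one_mul, List.forall_mem_ofFn_iff]
  by_cases hw : ∀ j, w j ∈ supp f
  · simp [hw]
  · obtain ⟨j, hj⟩ := not_forall.mp hw
    have : wordWeight f.coeff w = 0 :=
      Finset.prod_eq_zero (Finset.mem_univ j) (not_not.mp hj)
    simp [this]

end Words

/-! ### Coefficients of the `bᵢ` -/

/-- The common exponent, up to sign, of the elements in the support of a `bᵢ`. -/
def exponent {m : ℕ} : DihedralGroup m → ZMod m
  | r a => a
  | sr a => a + 1

/-- Both terms `r c` and `sr (c - 1)` of `auxY c` have exponent `c`. The element `sr (-1 - c)` of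
`auxT c` has exponent `-c`, which is `c` because `auxT` occurs only with `2c = 0`. -/
lemma bElt_coeff_of_mem_supp {m : ℕ} [NeZero m] {i : Index m} {g : DihedralGroup m}
    (hg : g ∈ supp (bElt m i)) :
    (bElt m i).coeff g = 1 ∧ exponent g = (auxLbl i : ℕ) := by
  change (bElt m i).coeff g ≠ 0 at hg
  rcases i with _ | _ | h | h | ⟨i, h⟩ | ⟨i, h⟩ <;> rcases g with a | a <;>
    simp [bElt_e, bElt_rs, bElt_rk, bElt_rks, bElt_y, bElt_yrs, auxE, auxT, auxY,
      Finsupp.single_apply, -r_zero] at hg ⊢ <;>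
    refine ⟨hg, ?_⟩ <;> subst hg <;> simp only [exponent, auxLbl] <;>
    try rw [auxCast_sub (by omega)]
  all_goals try simp
  -- Only `rks` is left, where `-k = k` has to be checked for `m = 2k`.
  all_goals
    rename Even m => h
    have h2 : ((m / 2 : ℕ) : ZMod m) + ((m / 2 : ℕ) : ZMod m) = 0 := by
      rw [← Nat.cast_add, ← two_mul, Nat.two_mul_div_two_of_even h, ZMod.natCast_self]
    linear_combination -h2

lemma auxLbl_lt {m : ℕ} [NeZero m] (i : Index m) : auxLbl i < m := by
  have := NeZero.pos m
  rcases i with _ | _ | h | h | ⟨i, h⟩ | ⟨i, h⟩ <;> simp only [auxLbl] <;> omega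

/-- The exponent of `g` fixes the label, as labels lie in `[0, m)`. The values `i < m/2` and `m - i
> m/2` are distinct from each other and from `0` and `m/2`, so the only ties are `e` with `rs` and
`rk` with `rks`; there one element is a rotation and the other a reflection (`hrot`). -/
lemma eq_of_mem_supp_bElt {m : ℕ} [NeZero m] {i j : Index m} {g : DihedralGroup m}
    (hi : g ∈ supp (bElt m i)) (hj : g ∈ supp (bElt m j)) : i = j := by
  have hm := NeZero.pos m
  have h := auxCast (auxLbl_lt i) (auxLbl_lt j)
    ((bElt_coeff_of_mem_supp hi).2.symm.trans (bElt_coeff_of_mem_supp hj).2)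
  have hrot {c d : ZMod m} (hc : g ∈ supp (auxE c)) (hd : g ∈ supp (auxT d)) : False := by
    rcases g with a | a <;> simp [supp, auxE, auxT] at hc hd
  rcases i with _ | _ | h1 | h1 | ⟨i, h1⟩ | ⟨i, h1⟩ <;>
    rcases j with _ | _ | h2 | h2 | ⟨j, h2⟩ | ⟨j, h2⟩ <;>
    simp only [auxLbl] at h <;>
    try simp only [bElt_e, bElt_rs, bElt_rk, bElt_rks] at hi hj
  all_goals try have h1' := even_iff_two_dvd.mp h1
  all_goals try have h2' := even_iff_two_dvd.mp h2
  all_goals first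
    | rfl
    | (exfalso; omega)
    | (obtain rfl : i = j := by omega
       rfl)
    | exact (hrot hi hj).elim
    | exact (hrot hj hi).elim

/-- Disjoint supports and unit coefficients make evaluation at a point of `supp bᵢ` the coordinate
functional of `bᵢ`. -/
lemma bElt_coeff {m : ℕ} [NeZero m] {i : Index m} {g : DihedralGroup m}
    (hg : g ∈ supp (bElt m i)) (j : Index m) [Decidable (j = i)] :
    (bElt m j).coeff g = if j = i then 1 else 0 := by
  split_ifs with h
  · subst h; exact (bElt_coeff_of_mem_supp hg).1
  · by_contra hj
    exact h (eq_of_mem_supp_bElt hj hg)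

/-- The coefficients of `x ∈ Q` in the basis `{bᵢ}` can be read off at any point of `supp bᵢ`. -/
lemma eq_sum_coeff_smul_b {m : ℕ} [NeZero m] (σ : Index m → DihedralGroup m)
    (hσ : ∀ i, σ i ∈ supp (b i : ℝ[DihedralGroup m])) (x : dihedralQ m) :
    x = ∑ i, (x : ℝ[DihedralGroup m]).coeff (σ i) • b i := by
  classical
  obtain ⟨c, hc⟩ := (Submodule.mem_span_range_iff_exists_fun ℝ).mp x.2
  have hcoeff (i : Index m) : (x : ℝ[DihedralGroup m]).coeff (σ i) = c i := by
    rw [← hc]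
    simp [bElt_coeff (hσ i)]
  ext1
  simp only [hcoeff, AddSubmonoidClass.coe_finsetSum, SetLike.val_smul]
  exact hc.symm

end DihedralWords

end
-- The multiplicity formula
open scoped Classical in
theorem mainTheorem2 (𝕜 : Type*) [RCLike 𝕜] (m : ℕ) [NeZero m] (δ : ℤˣ)
    {V : Type*} [AddCommGroup V] [Module 𝕜 V] [FiniteDimensional 𝕜 V]
    (ρ : Representation 𝕜 (DihedralGroup m) V)
    (f : DihedralWords.dihedralQ m)
    (hf : (DihedralWords.theta 𝕜 m δ f : DihedralGroup m → 𝕜) = ρ.character)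
    {S : Type*} [AddCommGroup S] [Module 𝕜 S] [FiniteDimensional 𝕜 S]
    (τ : Representation 𝕜 (DihedralGroup m) S) (hτ : τ.IsIrreducible)
    (σ : DihedralWords.Index m → DihedralGroup m)
    (hσ : ∀ i, σ i ∈ DihedralWords.supp (DihedralWords.b i : ℝ[DihedralGroup m]))
    (d : ℕ) :
    (DihedralWords.simpleMultiplicity τ (DihedralWords.tensorPower ρ d) : ℝ) =
      ∑ i : DihedralWords.Index m with
          (DihedralWords.theta 𝕜 m δ (DihedralWords.b i) : DihedralGroup m → 𝕜) = τ.character,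
        ∑ w ∈ DihedralWords.words (DihedralWords.supp (f : ℝ[DihedralGroup m])) d (σ i),
          DihedralWords.wordWeight (f : ℝ[DihedralGroup m]).coeff w := by
  have hchar : (DihedralWords.tensorPower ρ d).character =
      ∑ i, ((f ^ d : DihedralWords.dihedralQ m) : ℝ[DihedralGroup m]).coeff (σ i) •
        (DihedralWords.theta 𝕜 m δ (DihedralWords.b i) : DihedralGroup m → 𝕜) := by
    -- The power is moved inside `θ`, so that `f ^ d` can be expanded in `Q` before `θ` is applied
    -- linearly.
    rw [DihedralWords.character_tensorPower, ← hf, ← SubmonoidClass.coe_pow, ← map_pow]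
    conv_lhs => rw [DihedralWords.eq_sum_coeff_smul_b σ hσ (f ^ d)]
    simp only [map_sum, map_smul, AddSubmonoidClass.coe_finsetSum, SetLike.val_smul]
  -- The remaining obligation `?_` is that each `θ(bᵢ)` is an irreducible character.
  rw [DihedralWords.simpleMultiplicity_eq_sum τ _ hτ _ (fun i => ?_) _ hchar]
  · simp only [DihedralWords.sum_words, SubmonoidClass.coe_pow]
  · rw [DihedralWords.theta_b]
    exact DihedralWords.indexChar_mem δ i
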